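/- Let $q$ be a nonzero complex number with $q^m\neq 1$ for all integers $m\ge 1$, let $c^2$ be a nonzero real number, and let $N=2n+\epsilon\ge 3$ with $\epsilon\in\{0,1\}$. For $1\le i\le N$ put $i'=N+1-i$, and $\rho_i=N/2-i$ if $i<i'$, $\rho_i=-(N/2-i')$ if $i>i'$, $\rho_i=0$ if $i=i'$. Define $$C^{ij}=C_{ij}=q^{-2\rho_i}\delta_{ij'},\qquad K^{ij}_{kl}=C^{ij}C_{kl},$$ $$\hat R^{ij}_{kl}=q^{2\delta_{ij}-2\delta_{ij'}}\delta_{il}\delta_{jk}+(q^2-q^{-2})\,\delta_{i<l}\,(\delta_{ik}\delta_{jl}-K^{ij}_{kl}),$$ $$P_+=\frac{1}{q^2+q^{-2}}\Bigl(q^{-2}\,\mathrm{id}+\hat R-\frac{(q+q^{-1})(q-q^{-1})}{q^{2N}-1}K\Bigr),$$ where $\delta_{i<l}=1$ if $i<l$ and $\delta_{i<l}=0$ otherwise. Let $\mathrm{Cl}_q(N)$ be the unital associative complex algebra with generators $\gamma_1,\dots,\gamma_N$ and relations $$\sum_{k,l}(P_+)^{kl}_{ij}\gamma_k\gamma_l=0\quad(1\le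 i,j\le N),\qquad \sum_{i,j}C^{ij}\gamma_i\gamma_j=c^2\,\frac{q^{2N}-1}{q^2-1}.$$ It is $\mathbb Z^n$-graded by $\partial=(\partial_1,\dots,\partial_n)$ with $\partial_i(\gamma_j)=\delta_{ij}-\delta_{ij'}$ for $1\le i\le n$, $1\le j\le N$. Let $\mathrm{Cl}_q(N)_0$ be the subalgebra of elements of $\mathbb Z^n$-degree zero. Then $\mathrm{Cl}_q(N)_0$ is commutative. Moreover, $\mathrm{Cl}_q(N)_0$ is generated as a unital algebra by $\{\gamma_i\gamma_{i'}: 1\le i\le n\}$ if $N=2n$, and by $\{\gamma_{n+1}\}\cup\{\gamma_i\gamma_{i'}: 1\le i\le n\}$ if $N=2n+1$. -/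

import Mathlib

open scoped DirectSum

namespace FRTClifford

/-! The index set `{1, …, N}` is `Fin N`: the number `i` of the text is `⟨i - 1, _⟩ : Fin N`.
The involution `i ↦ i' = N + 1 - i` is then `Fin.rev`. -/

/-- `2 ρ_i`, where `ρ_i = N/2 - i` for `i < i'`, `ρ_i = -(N/2 - i')` for `i' < i`, and `ρ_i = 0`
for `i = i'`. -/
def twoRho {N : ℕ} (i : Fin N) : ℤ :=
  if i < i.rev then (N : ℤ) - 2 * (((i : ℕ) : ℤ) + 1)
  else if i.rev < i then -((N : ℤ) - 2 * (((i.rev : ℕ) : ℤ) + 1))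
  else 0

/-- The metric `C^{ij} = C_{ij} = q^{-2ρ_i} δ_{i j'}`. -/
noncomputable def metricC (q : ℂ) {N : ℕ} (i j : Fin N) : ℂ :=
  if i = j.rev then q ^ (-twoRho i) else 0

/-- `K^{ij}_{kl} = C^{ij} C_{kl}`; the row index is `(i, j)`, the column index is `(k, l)`. -/
noncomputable def matK (q : ℂ) (N : ℕ) : Matrix (Fin N × Fin N) (Fin N × Fin N) ℂ :=
  fun a b => metricC q a.1 a.2 * metricC q b.1 b.2

/-- The `R`-matrix of the quantum group `O_{q²}(N)`:
`R^{ij}_{kl} = q^{2δ_{ij} - 2δ_{ij'}} δ_{il} δ_{jk}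
  + (q² - q⁻²) δ_{i<l} (δ_{ik} δ_{jl} - K^{ij}_{kl})`. -/
noncomputable def matR (q : ℂ) (N : ℕ) : Matrix (Fin N × Fin N) (Fin N × Fin N) ℂ :=
  fun a b =>
    q ^ ((if a.1 = a.2 then (2 : ℤ) else 0) - (if a.1 = a.2.rev then (2 : ℤ) else 0))
        * (if a.1 = b.2 ∧ a.2 = b.1 then 1 else 0)
      + (q ^ 2 - (q ^ 2)⁻¹) * (if a.1 < b.2 then 1 else 0)
        * ((if a.1 = b.1 ∧ a.2 = b.2 then 1 else 0) - matK q N a b)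

/-- `P₊ = (q² + q⁻²)⁻¹ (q⁻² id + R - (q + q⁻¹)(q - q⁻¹) / (q^{2N} - 1) K)`. -/
noncomputable def projPlus (q : ℂ) (N : ℕ) : Matrix (Fin N × Fin N) (Fin N × Fin N) ℂ :=
  (1 / (q ^ 2 + (q ^ 2)⁻¹)) •
    ((q ^ 2)⁻¹ • (1 : Matrix (Fin N × Fin N) (Fin N × Fin N) ℂ) + matR q N
      - ((q + q⁻¹) * (q - q⁻¹) / (q ^ (2 * N) - 1)) • matK q N)

/-- The defining relations `P₊^{kl}_{ij} γ_k γ_l = 0` and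
`C^{ij} γ_i γ_j = c² (q^{2N} - 1) / (q² - 1)` in the free algebra; `c2` stands for `c²`. -/
inductive Rel (q c2 : ℂ) (N : ℕ) : FreeAlgebra ℂ (Fin N) → FreeAlgebra ℂ (Fin N) → Prop
  | plus (i j : Fin N) : Rel q c2 N
      (∑ k, ∑ l, projPlus q N (k, l) (i, j) • (FreeAlgebra.ι ℂ k * FreeAlgebra.ι ℂ l)) 0
  | metric : Rel q c2 N
      (∑ i, ∑ j, metricC q i j • (FreeAlgebra.ι ℂ i * FreeAlgebra.ι ℂ j))
      (algebraMap ℂ (FreeAlgebra ℂ (Fin N)) (c2 * ((q ^ (2 * N) - 1) / (q ^ 2 - 1))))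

/-- The FRT-Clifford algebra `Cl_q(N)` with parameter `c2 = c²`. -/
abbrev Cl (q c2 : ℂ) (N : ℕ) : Type := RingQuot (Rel q c2 N)

/-- The generators `γ_i`. -/
noncomputable def gamma (q c2 : ℂ) {N : ℕ} (i : Fin N) : Cl q c2 N :=
  RingQuot.mkAlgHom ℂ (Rel q c2 N) (FreeAlgebra.ι ℂ i)

/-- The degree of `γ_j` in `ℤⁿ`, `n = ⌊N/2⌋`: its `i`-th component is `δ_{ij} - δ_{ij'}`. -/
def deg {N : ℕ} (j : Fin N) : Fin (N / 2) → ℤ :=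
  fun i => (if (i : ℕ) = j then 1 else 0) - (if (i : ℕ) = j.rev then 1 else 0)

/-- The homogeneous component of degree `d`: the span of all words `γ_{j₁} ⋯ γ_{jₖ}` with
`deg j₁ + ⋯ + deg jₖ = d`. -/
noncomputable def piece (q c2 : ℂ) (N : ℕ) (d : Fin (N / 2) → ℤ) : Submodule ℂ (Cl q c2 N) :=
  Submodule.span ℂ
    {x | ∃ w : List (Fin N), (w.map deg).sum = d ∧ x = (w.map (gamma q c2)).prod}

instance pieceGradedMonoid (q c2 : ℂ) (N : ℕ) : SetLike.GradedMonoid (piece q c2 N) where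
  one_mem := Submodule.subset_span ⟨[], by simp, by simp⟩
  mul_mem := by
    intro d e x y hx hy
    have h := Submodule.mul_mem_mul hx hy
    rw [piece, piece, Submodule.span_mul_span] at h
    refine Submodule.span_mono ?_ h
    rintro _ ⟨_, ⟨w, hw, rfl⟩, _, ⟨v, hv, rfl⟩, rfl⟩
    exact ⟨w ++ v, by simp [hw, hv], by simp⟩

theorem gamma_mem (q c2 : ℂ) {N : ℕ} (j : Fin N) : gamma q c2 j ∈ piece q c2 N (deg j) :=
  Submodule.subset_span ⟨[j], by simp, by simp⟩

theorem deg_rev {N : ℕ} (j : Fin N) : deg j.rev = -deg j := by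
  funext i
  simp [deg, Fin.rev_rev]

theorem deg_of_metricC_ne {q : ℂ} {N : ℕ} {i j : Fin N} (h : metricC q i j ≠ 0) :
    deg i + deg j = 0 := by
  have hij : i = j.rev := by
    by_contra hne
    exact h (by simp [metricC, hne])
  rw [hij, deg_rev]; simp

theorem deg_of_projPlus_ne {q : ℂ} {N : ℕ} {k l i j : Fin N}
    (h : projPlus q N (k, l) (i, j) ≠ 0) : deg k + deg l = deg i + deg j := by
  by_contra hd
  have h1 : ¬ (k = i ∧ l = j) := by rintro ⟨rfl, rfl⟩; exact hd rfl
  have h2 : ¬ (k = j ∧ l = i) := by rintro ⟨rfl, rfl⟩; exact hd (add_comm _ _)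
  have h3 : matK q N (k, l) (i, j) = 0 := by
    by_contra hK
    have hK' := mul_ne_zero_iff.mp hK
    exact hd ((deg_of_metricC_ne hK'.1).trans (deg_of_metricC_ne hK'.2).symm)
  apply h
  have h4 : matR q N (k, l) (i, j) = 0 := by
    simp [matR, h1, h2, h3]
  have h5 : (1 : Matrix (Fin N × Fin N) (Fin N × Fin N) ℂ) (k, l) (i, j) = 0 :=
    Matrix.one_apply_ne (by simpa [Prod.ext_iff] using h1)
  simp [projPlus, h3, h4, h5]

/-- The generator `γ_j` as an element of the direct sum of the homogeneous components. -/
noncomputable def gammaSum (q c2 : ℂ) {N : ℕ} (j : Fin N) : ⨁ d, piece q c2 N d :=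
  DirectSum.of (fun d => piece q c2 N d) (deg j) ⟨gamma q c2 j, gamma_mem q c2 j⟩

theorem of_congr {q c2 : ℂ} {N : ℕ} {d e : Fin (N / 2) → ℤ} (h : d = e)
    (x : piece q c2 N d) (y : piece q c2 N e) (hxy : (x : Cl q c2 N) = y) :
    DirectSum.of (fun d => piece q c2 N d) d x = DirectSum.of (fun d => piece q c2 N d) e y := by
  subst h
  congr 1
  exact Subtype.ext hxy

theorem gammaSum_rel {q c2 : ℂ} {N : ℕ} (a : Fin N → Fin N → ℂ) (d : Fin (N / 2) → ℤ)
    (ha : ∀ k l, a k l ≠ 0 → deg k + deg l = d)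
    (y : piece q c2 N d)
    (hy : ∑ k, ∑ l, a k l • (gamma q c2 k * gamma q c2 l) = (y : Cl q c2 N)) :
    ∑ k, ∑ l, a k l • (gammaSum q c2 k * gammaSum q c2 l)
      = DirectSum.of (fun d => piece q c2 N d) d y := by
  have hmem : ∀ k l, a k l • (gamma q c2 k * gamma q c2 l) ∈ piece q c2 N d := by
    intro k l
    by_cases h : a k l = 0
    · simp [h]
    · rw [← ha k l h]
      exact Submodule.smul_mem _ _
        (SetLike.GradedMul.mul_mem (gamma_mem q c2 k) (gamma_mem q c2 l))
  have hterm : ∀ k l, a k l • (gammaSum q c2 k * gammaSum q c2 l)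
      = DirectSum.lof ℂ _ (fun d => piece q c2 N d) d ⟨_, hmem k l⟩ := by
    intro k l
    by_cases h : a k l = 0
    · have : (⟨_, hmem k l⟩ : piece q c2 N d) = 0 := Subtype.ext (by simp [h])
      rw [this, h, map_zero, zero_smul]
    · rw [gammaSum, gammaSum, DirectSum.of_mul_of, ← DirectSum.lof_eq_of ℂ, ← map_smul,
        DirectSum.lof_eq_of, DirectSum.lof_eq_of]
      exact of_congr (ha k l h) _ _ rfl
  simp_rw [hterm, ← map_sum]
  rw [DirectSum.lof_eq_of]
  congr 1
  apply Subtype.ext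
  simpa using hy

/-- The map `γ_j ↦ γ_j` from the Clifford algebra to the direct sum of its components. -/
noncomputable def decomposeHom (q c2 : ℂ) (N : ℕ) : Cl q c2 N →ₐ[ℂ] ⨁ d, piece q c2 N d :=
  RingQuot.liftAlgHom ℂ ⟨FreeAlgebra.lift ℂ (gammaSum q c2), by
    intro x y hxy
    have hrel := RingQuot.mkAlgHom_rel ℂ hxy
    cases hxy with
    | plus i j =>
      simp only [map_sum, map_smul, map_mul, FreeAlgebra.lift_ι_apply, map_zero] at hrel ⊢
      rw [gammaSum_rel _ (deg i + deg j) (fun k l h => deg_of_projPlus_ne h) 0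
        (by simpa [gamma] using hrel), map_zero]
    | metric =>
      simp only [map_sum, map_smul, map_mul, FreeAlgebra.lift_ι_apply, AlgHom.commutes]
        at hrel ⊢
      rw [gammaSum_rel _ 0 (fun k l h => deg_of_metricC_ne h)
        ⟨algebraMap ℂ _ (c2 * ((q ^ (2 * N) - 1) / (q ^ 2 - 1))),
          SetLike.algebraMap_mem_graded _ _⟩ (by simpa [gamma] using hrel),
        ← map_mul]
      rfl⟩

theorem decomposeHom_gamma (q c2 : ℂ) {N : ℕ} (j : Fin N) :
    decomposeHom q c2 N (gamma q c2 j) = gammaSum q c2 j := by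
  simp [decomposeHom, gamma]

theorem decomposeHom_word (q c2 : ℂ) {N : ℕ} (w : List (Fin N))
    (h : (w.map (gamma q c2)).prod ∈ piece q c2 N (w.map deg).sum) :
    decomposeHom q c2 N (w.map (gamma q c2)).prod
      = DirectSum.of (fun d => piece q c2 N d) (w.map deg).sum ⟨_, h⟩ := by
  induction w with
  | nil => exact map_one (decomposeHom q c2 N)
  | cons j w ih =>
    have h' : (w.map (gamma q c2)).prod ∈ piece q c2 N (w.map deg).sum :=
      Submodule.subset_span ⟨w, rfl, rfl⟩
    simp only [List.map_cons, List.prod_cons, map_mul]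
    rw [ih h', decomposeHom_gamma, gammaSum, DirectSum.of_mul_of]
    exact of_congr (by simp) _ _ rfl

/-- The components `piece q c2 N d` form a `ℤⁿ`-grading of the algebra `Cl q c2 N`. -/
noncomputable instance pieceGradedAlgebra (q c2 : ℂ) (N : ℕ) :
    GradedAlgebra (piece q c2 N) :=
  GradedAlgebra.ofAlgHom (piece q c2 N) (decomposeHom q c2 N)
    (by
      apply RingQuot.ringQuot_ext'
      apply FreeAlgebra.hom_ext
      funext j
      have := decomposeHom_gamma q c2 j
      simp only [gamma] at this
      simp [this, gammaSum, gamma])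
    (by
      rintro d ⟨x, hx⟩
      induction hx using Submodule.span_induction with
      | mem x hx =>
        obtain ⟨w, rfl, rfl⟩ := hx
        exact decomposeHom_word q c2 w _
      | zero => exact (map_zero _).trans (map_zero _).symm
      | add x y hx hy ihx ihy =>
        simp only [map_add] at ihx ihy ⊢
        rw [ihx, ihy, ← map_add]
        rfl
      | smul a x hx ih =>
        simp only [map_smul] at ih ⊢
        rw [ih, ← DirectSum.lof_eq_of ℂ, ← map_smul]
        rfl)

/-- The subalgebra of all elements of `ℤⁿ`-degree zero. -/
noncomputable def Clz (q c2 : ℂ) (N : ℕ) : Subalgebra ℂ (Cl q c2 N) :=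
  SetLike.GradeZero.subalgebra (piece q c2 N)

end FRTClifford

namespace FRTClifford

/-! ### Quadratic relations between the generators -/

section Relations

variable {q c2 : ℂ} {N : ℕ}

/-! Unless `j = i'`, two generators commute up to a nonzero scalar, and `γ_i² = 0` for `i ≠ i'`.
Take a word of degree zero starting with `γ_j`, `j ≠ j'`. It contains `j'` as often as `j`, so some
`γ_{j'}` occurs later. If another `γ_j` comes before it, the two `γ_j` can be brought together and
the word vanishes; otherwise `γ_{j'}` moves up to the first letter and a factor `γ_j γ_{j'}` splits
off a shorter word. A leading middle generator has degree zero and splits off at once. Induction on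
length (`word_mem`) gives generation, since `gamma_rev_mul_gamma` rewrites `γ_{i'} γ_i` through the
products `γ_k γ_{k'}` with `k ≤ i`. For commutativity, the scalars from moving `γ_j` past `γ_i` and
past `γ_{i'}` cancel when `i < j < i'` (`commute_gamma_mul_gamma_rev`), and any two distinct pairs
are nested. -/

theorem sum_metricC_smul_gamma :
    ∑ k : Fin N, ∑ l, metricC q k l • (gamma q c2 k * gamma q c2 l)
      = algebraMap ℂ (Cl q c2 N) (c2 * ((q ^ (2 * N) - 1) / (q ^ 2 - 1))) := by
  have h := RingQuot.mkAlgHom_rel ℂ (Rel.metric (q := q) (c2 := c2) (N := N))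
  simp only [map_sum, map_smul, map_mul, AlgHom.commutes] at h ⊢
  exact h

theorem sum_projPlus_smul_gamma (i j : Fin N) :
    ∑ k, ∑ l, projPlus q N (k, l) (i, j) • (gamma q c2 k * gamma q c2 l) = 0 := by
  have h := RingQuot.mkAlgHom_rel ℂ (Rel.plus (q := q) (c2 := c2) i j)
  simp only [map_sum, map_smul, map_mul, map_zero] at h
  exact h

/-- The relation `P₊ γ γ = 0` in row `(i, j)`, written out. -/
theorem gamma_relation (hQ : q ^ 2 + (q ^ 2)⁻¹ ≠ 0) (i j : Fin N) : ∃ a : ℂ,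
    (q ^ 2)⁻¹ • (gamma q c2 i * gamma q c2 j)
      + q ^ ((if j = i then (2 : ℤ) else 0) - (if j = i.rev then (2 : ℤ) else 0))
          • (gamma q c2 j * gamma q c2 i)
      + (q ^ 2 - (q ^ 2)⁻¹) • (if i < j then gamma q c2 i * gamma q c2 j else 0)
      = ((q ^ 2 - (q ^ 2)⁻¹) * metricC q i j) •
          (∑ k ∈ Finset.univ.filter (· < j), q ^ (-twoRho k) • (gamma q c2 k * gamma q c2 k.rev))
        + metricC q i j • algebraMap ℂ (Cl q c2 N) a := by
  set b : ℂ := (q + q⁻¹) * (q - q⁻¹) / (q ^ (2 * N) - 1) with hb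
  -- The `K`-term of `P₊` contributes `b C_{ij} ∑ C^{kl} γ_k γ_l`, and the metric relation makes
  -- that sum a constant.
  refine ⟨b * (c2 * ((q ^ (2 * N) - 1) / (q ^ 2 - 1))), ?_⟩
  have h := sum_projPlus_smul_gamma (q := q) (c2 := c2) i j
  have hS : ∑ k ∈ Finset.univ.filter (· < j),
        q ^ (-twoRho k) • (gamma q c2 k * gamma q c2 k.rev)
      = ∑ k, ∑ l, (if k < j then metricC q k l else 0) • (gamma q c2 k * gamma q c2 l) := by
    rw [Finset.sum_filter]
    refine Finset.sum_congr rfl fun k _ => ?_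
    rw [Finset.sum_eq_single k.rev]
    · simp [metricC]
    · intro l _ hl
      have : k ≠ l.rev := fun h => hl (by simp [h])
      simp [metricC, this]
    · simp
  have h1 : ∑ k, ∑ l, (if k = i ∧ l = j then (1 : ℂ) else 0) • (gamma q c2 k * gamma q c2 l)
      = gamma q c2 i * gamma q c2 j := by
    simp [ite_and, Finset.sum_ite_eq', ite_smul]
  have h2 : ∑ k, ∑ l,
      (q ^ ((if k = l then (2 : ℤ) else 0) - (if k = l.rev then (2 : ℤ) else 0))
        * (if k = j ∧ l = i then (1 : ℂ) else 0)) • (gamma q c2 k * gamma q c2 l)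
      = q ^ ((if j = i then (2 : ℤ) else 0) - (if j = i.rev then (2 : ℤ) else 0))
          • (gamma q c2 j * gamma q c2 i) := by
    rw [Finset.sum_eq_single j, Finset.sum_eq_single i]
    · simp
    · intro l _ hl; simp [hl]
    · simp
    · intro k _ hk; simp [hk]
    · simp
  have h3 : ∑ k, ∑ l, (if k < j ∧ k = i ∧ l = j then (1 : ℂ) else 0) •
        (gamma q c2 k * gamma q c2 l)
      = if i < j then gamma q c2 i * gamma q c2 j else 0 := by
    rw [Finset.sum_eq_single i, Finset.sum_eq_single j]
    · simp
    · intro l _ hl; simp [hl]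
    · simp
    · intro k _ hk; simp [hk]
    · simp
  have expand : ∀ k l, projPlus q N (k, l) (i, j) • (gamma q c2 k * gamma q c2 l)
      = (1 / (q ^ 2 + (q ^ 2)⁻¹)) •
        ((q ^ 2)⁻¹ • ((if k = i ∧ l = j then (1 : ℂ) else 0) • (gamma q c2 k * gamma q c2 l))
        + (q ^ ((if k = l then (2 : ℤ) else 0) - (if k = l.rev then (2 : ℤ) else 0))
            * (if k = j ∧ l = i then (1 : ℂ) else 0)) • (gamma q c2 k * gamma q c2 l)
        + (q ^ 2 - (q ^ 2)⁻¹) • ((if k < j ∧ k = i ∧ l = j then (1 : ℂ) else 0) •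
            (gamma q c2 k * gamma q c2 l))
        - ((q ^ 2 - (q ^ 2)⁻¹) * metricC q i j) •
            ((if k < j then metricC q k l else 0) • (gamma q c2 k * gamma q c2 l))
        - (b * metricC q i j) • (metricC q k l • (gamma q c2 k * gamma q c2 l))) := by
    intro k l
    simp only [projPlus, matR, matK, Matrix.smul_apply, Matrix.sub_apply, Matrix.add_apply,
      Matrix.one_apply, Prod.mk.injEq, smul_eq_mul, ← hb, smul_smul, ← add_smul, ← sub_smul]
    congr 2
    simp only [ite_and]
    split_ifs <;> ring
  simp only [expand, ← Finset.smul_sum, Finset.sum_add_distrib, Finset.sum_sub_distrib] at h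
  rw [h1, h2, h3, ← hS, sum_metricC_smul_gamma] at h
  have h' := (smul_eq_zero.mp h).resolve_left (one_div_ne_zero hQ)
  rw [sub_sub, sub_eq_zero] at h'
  rw [h', map_mul _ b, mul_comm b, mul_smul (metricC q i j), Algebra.smul_def b]



theorem gamma_mul_gamma_of_lt (hQ : q ^ 2 + (q ^ 2)⁻¹ ≠ 0) {i j : Fin N}
    (hij : i < j) (h : j ≠ i.rev) :
    gamma q c2 j * gamma q c2 i = (-q ^ 2) • (gamma q c2 i * gamma q c2 j) := by
  obtain ⟨a, ha⟩ := gamma_relation (c2 := c2) hQ i j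
  have hC : metricC q i j = 0 := if_neg fun h' => h (by simp [h'])
  simp only [hC, hij, hij.ne', h, if_true, if_false, mul_zero, zero_smul, add_zero, sub_zero,
    zpow_zero, one_smul] at ha
  rw [← sub_eq_zero, ← ha]
  module

theorem gamma_mul_self (hQ : q ^ 2 + (q ^ 2)⁻¹ ≠ 0) {i : Fin N} (h : i ≠ i.rev) :
    gamma q c2 i * gamma q c2 i = 0 := by
  obtain ⟨a, ha⟩ := gamma_relation (c2 := c2) hQ i i
  have hC : metricC q i i = 0 := if_neg h
  simp only [hC, h, lt_irrefl, if_true, if_false, mul_zero, zero_smul, add_zero, sub_zero,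
    smul_zero, ← add_smul] at ha
  refine (smul_eq_zero.mp ha).resolve_left ?_
  rw [add_comm]
  exact_mod_cast hQ

/-- This is row `(i', i)` of the relations: the sum over `k < i` contains only pairs outside `{i,
i'}`. The values of the scalars do not matter for membership in a subalgebra. -/
theorem gamma_rev_mul_gamma (hq0 : q ≠ 0) (hQ : q ^ 2 + (q ^ 2)⁻¹ ≠ 0) {i : Fin N}
    (hi : i < i.rev) : ∃ a b : ℂ, gamma q c2 i.rev * gamma q c2 i
      = a • (∑ k ∈ Finset.univ.filter (· < i),
          q ^ (-twoRho k) • (gamma q c2 k * gamma q c2 k.rev))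
        + algebraMap ℂ (Cl q c2 N) b - gamma q c2 i * gamma q c2 i.rev := by
  obtain ⟨a, ha⟩ := gamma_relation (c2 := c2) hQ i.rev i
  have hq2 : q ^ 2 ≠ 0 := pow_ne_zero 2 hq0
  have hpow : q ^ ((0 : ℤ) - 2) = (q ^ 2)⁻¹ := by
    rw [zero_sub, zpow_neg]; norm_cast
  simp only [Fin.rev_rev, hi.ne, hi.not_gt, if_true, if_false, smul_zero, add_zero, hpow,
    ← smul_add] at ha
  rw [inv_smul_eq_iff₀ hq2, smul_add, smul_smul, smul_smul, Algebra.smul_def (q ^ 2 * _),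
    Algebra.smul_def (q ^ 2 * _), ← map_mul, ← Algebra.smul_def] at ha
  exact ⟨_, _, eq_sub_of_add_eq ha⟩

theorem gamma_mul_gamma_eq_smul (hq0 : q ≠ 0) (hQ : q ^ 2 + (q ^ 2)⁻¹ ≠ 0) {k j : Fin N}
    (h : k ≠ j.rev) :
    ∃ a : ℂ, gamma q c2 k * gamma q c2 j = a • (gamma q c2 j * gamma q c2 k) := by
  rcases lt_trichotomy k j with hkj | rfl | hjk
  · have h' : j ≠ k.rev := fun e => h (by simp [e])
    refine ⟨(-q ^ 2)⁻¹, ?_⟩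
    rw [gamma_mul_gamma_of_lt hQ hkj h',
      inv_smul_smul₀ (neg_ne_zero.mpr (pow_ne_zero 2 hq0))]
  · exact ⟨1, (one_smul _ _).symm⟩
  · exact ⟨_, gamma_mul_gamma_of_lt hQ hjk h⟩

theorem word_mul_gamma_eq_smul (hq0 : q ≠ 0) (hQ : q ^ 2 + (q ^ 2)⁻¹ ≠ 0) {j : Fin N}
    (u : List (Fin N)) (hu : j.rev ∉ u) : ∃ a : ℂ,
    (u.map (gamma q c2)).prod * gamma q c2 j = a • (gamma q c2 j * (u.map (gamma q c2)).prod) := by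
  induction u with
  | nil => exact ⟨1, by simp⟩
  | cons k u ih =>
    rw [List.mem_cons, not_or] at hu
    obtain ⟨a, ha⟩ := ih hu.2
    obtain ⟨b, hb⟩ := gamma_mul_gamma_eq_smul (c2 := c2) hq0 hQ (Ne.symm hu.1)
    refine ⟨a * b, ?_⟩
    rw [List.map_cons, List.prod_cons, mul_assoc, ha, mul_smul_comm, ← mul_assoc, hb,
      smul_mul_assoc, smul_smul, mul_assoc]

/-- Both `γ_j γ_i = -q² γ_i γ_j` and `γ_{i'} γ_j = -q² γ_j γ_{i'}` hold, so the two factors agree on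
either side. -/
theorem commute_gamma_mul_gamma_rev (hQ : q ^ 2 + (q ^ 2)⁻¹ ≠ 0) {i j : Fin N}
    (hij : i < j) (hji : j < i.rev) :
    Commute (gamma q c2 i * gamma q c2 i.rev) (gamma q c2 j) := by
  have h1 := gamma_mul_gamma_of_lt (c2 := c2) hQ hij hji.ne
  have h2 := gamma_mul_gamma_of_lt (c2 := c2) hQ hji
    (fun e => hij.ne (Fin.rev_injective e))
  rw [Commute, SemiconjBy, mul_assoc, h2, ← mul_assoc (gamma q c2 j), h1, mul_smul_comm,
    smul_mul_assoc, mul_assoc]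

theorem commute_gamma_pair (hQ : q ^ 2 + (q ^ 2)⁻¹ ≠ 0) {i j : Fin N}
    (hi : i < i.rev) (hj : j < j.rev) :
    Commute (gamma q c2 i * gamma q c2 i.rev) (gamma q c2 j * gamma q c2 j.rev) := by
  wlog hij : i < j generalizing i j
  · rcases (not_lt.mp hij).eq_or_lt with rfl | hji
    · exact Commute.refl _
    · exact (this hj hi hji).symm
  have h := Fin.rev_lt_rev.mpr hij
  exact (commute_gamma_mul_gamma_rev hQ hij (hj.trans h)).mul_right
    (commute_gamma_mul_gamma_rev hQ (hij.trans hj) h)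

theorem gamma_mul_gamma_rev_mem (hq0 : q ≠ 0) (hQ : q ^ 2 + (q ^ 2)⁻¹ ≠ 0)
    (A : Subalgebra ℂ (Cl q c2 N))
    (hpair : ∀ i : Fin N, i < i.rev → gamma q c2 i * gamma q c2 i.rev ∈ A)
    (hmid : ∀ i : Fin N, i = i.rev → gamma q c2 i ∈ A) (j : Fin N) :
    gamma q c2 j * gamma q c2 j.rev ∈ A := by
  rcases lt_trichotomy j j.rev with h | h | h
  · exact hpair j h
  · rw [← h]; exact A.mul_mem (hmid j h) (hmid j h)
  · have h' : j.rev < j.rev.rev := by rwa [Fin.rev_rev]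
    obtain ⟨a, b, hab⟩ := gamma_rev_mul_gamma (c2 := c2) hq0 hQ h'
    have hp := hpair _ h'
    rw [Fin.rev_rev] at hab hp
    rw [hab]
    refine A.sub_mem (A.add_mem (A.smul_mem (A.sum_mem fun k hk => A.smul_mem (hpair k ?_) _) _)
      (A.algebraMap_mem _)) hp
    have hkj : k < j.rev := (Finset.mem_filter.mp hk).2
    -- Here `k < j' < j < k'`.
    exact hkj.trans (h.trans (by rw [Fin.lt_rev_iff]; exact hkj))

end Relations

/-! ### Letter counts in words of degree zero -/

section Degree

variable {N : ℕ}

theorem sum_deg_apply (w : List (Fin N)) (j : Fin N) (i : Fin (N / 2)) (hij : (i : ℕ) = j) :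
    (w.map deg).sum i = (w.count j : ℤ) - w.count j.rev := by
  induction w with
  | nil => simp
  | cons k w ih =>
    have h1 : ((i : ℕ) = k) ↔ k = j := by rw [hij, Fin.ext_iff, eq_comm]
    have h2 : ((i : ℕ) = k.rev) ↔ k = j.rev := by
      rw [hij, ← Fin.ext_iff]
      exact ⟨fun h => by simp [h], fun h => by simp [h]⟩
    simp only [List.map_cons, List.sum_cons, Pi.add_apply, ih, deg, h1, h2, List.count_cons,
      beq_iff_eq]
    push_cast
    ring

theorem count_rev_eq_count {w : List (Fin N)} (hw : (w.map deg).sum = 0) (j : Fin N) :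
    w.count j.rev = w.count j := by
  rcases lt_trichotomy j j.rev with h | h | h
  · have hj : (j : ℕ) < N / 2 := by
      rw [Fin.lt_def, Fin.val_rev] at h; omega
    have := sum_deg_apply w j ⟨j, hj⟩ rfl
    rw [hw, Pi.zero_apply] at this
    omega
  · rw [← h]
  · have hj : (j.rev : ℕ) < N / 2 := by
      rw [Fin.lt_def, Fin.val_rev] at h; rw [Fin.val_rev]; omega
    have := sum_deg_apply w j.rev ⟨j.rev, hj⟩ rfl
    rw [hw, Pi.zero_apply, Fin.rev_rev] at this
    omega

end Degree

/-! ### Generators and commutativity of the degree-zero part -/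

section DegreeZero

variable {q c2 : ℂ} {N : ℕ}

theorem word_mem (hq0 : q ≠ 0) (hQ : q ^ 2 + (q ^ 2)⁻¹ ≠ 0) (A : Subalgebra ℂ (Cl q c2 N))
    (hpair : ∀ i : Fin N, i < i.rev → gamma q c2 i * gamma q c2 i.rev ∈ A)
    (hmid : ∀ i : Fin N, i = i.rev → gamma q c2 i ∈ A)
    (w : List (Fin N)) (hw : (w.map deg).sum = 0) : (w.map (gamma q c2)).prod ∈ A := by
  induction hlen : w.length using Nat.strong_induction_on generalizing w with
  | _ m ih =>
  cases w with
  | nil => simp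
  | cons j t =>
    by_cases hj : j = j.rev
    · have hdeg : deg j = 0 := by
        have := deg_rev j
        rw [← hj] at this
        exact self_eq_neg.mp this
      rw [List.map_cons, List.prod_cons]
      refine A.mul_mem (hmid j hj) (ih t.length (by simp [← hlen]) t ?_ rfl)
      simpa [hdeg] using hw
    · have hmem : j.rev ∈ t := by
        have hc := count_rev_eq_count hw j
        rw [List.count_cons_self, List.count_cons_of_ne hj] at hc
        exact List.count_pos_iff.mp (by omega)
      -- The first occurrence of `j'` is chosen, so no `j'` lies in `u`, and `γ_j` can move through
      -- `u`.
      obtain ⟨u, v, rfl, hu⟩ := List.eq_append_cons_of_mem hmem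
      by_cases hju : j ∈ u
      · obtain ⟨s, r, rfl, -⟩ := List.eq_append_cons_of_mem hju
        have hs : j.rev ∉ s := fun h => hu (List.mem_append_left _ h)
        obtain ⟨a, ha⟩ := word_mul_gamma_eq_smul (c2 := c2) hq0 hQ s hs
        have hzero : gamma q c2 j * (s.map (gamma q c2)).prod * gamma q c2 j = 0 := by
          rw [mul_assoc, ha, mul_smul_comm, ← mul_assoc, gamma_mul_self hQ hj, zero_mul, smul_zero]
        have hprod : ((j :: ((s ++ j :: r) ++ j.rev :: v)).map (gamma q c2)).prod
            = (gamma q c2 j * (s.map (gamma q c2)).prod * gamma q c2 j)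
              * ((r ++ j.rev :: v).map (gamma q c2)).prod := by
          simp only [List.map_cons, List.map_append, List.prod_cons, List.prod_append, mul_assoc]
        rw [hprod, hzero, zero_mul]
        exact A.zero_mem
      · obtain ⟨a, ha⟩ := word_mul_gamma_eq_smul (c2 := c2) hq0 hQ (j := j.rev) u
          (by rwa [Fin.rev_rev])
        have hprod : ((j :: (u ++ j.rev :: v)).map (gamma q c2)).prod
            = a • ((gamma q c2 j * gamma q c2 j.rev) * ((u ++ v).map (gamma q c2)).prod) := by
          simp only [List.map_cons, List.map_append, List.prod_cons, List.prod_append]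
          rw [← mul_assoc (u.map (gamma q c2)).prod, ha, smul_mul_assoc, mul_smul_comm]
          simp only [mul_assoc]
        rw [hprod]
        refine A.smul_mem (A.mul_mem (gamma_mul_gamma_rev_mem hq0 hQ A hpair hmid j)
          (ih (u ++ v).length ?_ (u ++ v) ?_ rfl)) a
        · simp [← hlen]
        · simp only [List.map_cons, List.map_append, List.sum_cons, List.sum_append,
            deg_rev] at hw ⊢
          rw [← hw]; abel

theorem mem_Clz {x : Cl q c2 N} : x ∈ Clz q c2 N ↔ x ∈ piece q c2 N 0 := Iff.rfl

theorem Clz_le (hq0 : q ≠ 0) (hQ : q ^ 2 + (q ^ 2)⁻¹ ≠ 0) (A : Subalgebra ℂ (Cl q c2 N))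
    (hpair : ∀ i : Fin N, i < i.rev → gamma q c2 i * gamma q c2 i.rev ∈ A)
    (hmid : ∀ i : Fin N, i = i.rev → gamma q c2 i ∈ A) : Clz q c2 N ≤ A := by
  intro x hx
  have h : piece q c2 N 0 ≤ Subalgebra.toSubmodule A := by
    refine Submodule.span_le.mpr ?_
    rintro _ ⟨w, hw, rfl⟩
    exact word_mem hq0 hQ A hpair hmid w hw
  exact h (mem_Clz.mp hx)

theorem gamma_mem_Clz {i : Fin N} (hi : i = i.rev) : gamma q c2 i ∈ Clz q c2 N := by
  have h := gamma_mem q c2 i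
  have hdeg := deg_rev i
  rw [← hi] at hdeg
  rwa [self_eq_neg.mp hdeg] at h

theorem gamma_mul_gamma_rev_mem_Clz (i : Fin N) :
    gamma q c2 i * gamma q c2 i.rev ∈ Clz q c2 N := by
  have h := SetLike.GradedMul.mul_mem (gamma_mem q c2 i) (gamma_mem q c2 i.rev)
  rwa [deg_rev, add_neg_cancel] at h

/-- The degree-zero part is generated by `γ_i γ_{i'}` for `i < i'`, and `γ_i` for `i = i'`. -/
theorem Clz_eq_adjoin (hq0 : q ≠ 0) (hQ : q ^ 2 + (q ^ 2)⁻¹ ≠ 0) :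
    Clz q c2 N = Algebra.adjoin ℂ
      ({x | ∃ i : Fin N, i = i.rev ∧ x = gamma q c2 i} ∪
        {x | ∃ i : Fin N, i < i.rev ∧ x = gamma q c2 i * gamma q c2 i.rev}) := by
  refine le_antisymm (Clz_le hq0 hQ _
    (fun i hi => Algebra.subset_adjoin (Or.inr ⟨i, hi, rfl⟩))
    (fun i hi => Algebra.subset_adjoin (Or.inl ⟨i, hi, rfl⟩))) (Algebra.adjoin_le ?_)
  rintro _ (⟨i, hi, rfl⟩ | ⟨i, -, rfl⟩)
  · exact gamma_mem_Clz hi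
  · exact gamma_mul_gamma_rev_mem_Clz i

theorem commute_of_mem_Clz (hq0 : q ≠ 0) (hQ : q ^ 2 + (q ^ 2)⁻¹ ≠ 0) {x y : Cl q c2 N}
    (hx : x ∈ Clz q c2 N) (hy : y ∈ Clz q c2 N) : Commute x y := by
  rw [Clz_eq_adjoin hq0 hQ] at hx hy
  refine Algebra.commute_of_mem_adjoin_of_forall_mem_commute hy fun b hb =>
    (Algebra.commute_of_mem_adjoin_of_forall_mem_commute hx fun a ha => ?_).symm
  have key : ∀ {i j : Fin N}, i = i.rev → j < j.rev →
      Commute (gamma q c2 j * gamma q c2 j.rev) (gamma q c2 i) := by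
    intro i j hi hj
    refine commute_gamma_mul_gamma_rev hQ ?_ ?_ <;>
    · simp only [Fin.lt_def, Fin.ext_iff, Fin.val_rev] at hi hj ⊢
      omega
  obtain ⟨i, hi, rfl⟩ | ⟨i, hi, rfl⟩ := ha <;> obtain ⟨j, hj, rfl⟩ | ⟨j, hj, rfl⟩ := hb
  -- There is at most one index fixed by `i ↦ i'`.
  · have hij : i = j := by
      simp only [Fin.ext_iff, Fin.val_rev] at hi hj ⊢
      omega
    exact hij ▸ Commute.refl _
  · exact key hi hj
  · exact (key hj hi).symm
  · exact commute_gamma_pair hQ hj hi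

end DegreeZero

end FRTClifford

theorem mainTheorem11 (N : ℕ) (hN : 3 ≤ N) (q : ℂ) (hq0 : q ≠ 0)
    (hq : ∀ m : ℕ, 0 < m → q ^ m ≠ 1) (c2 : ℝ) (hc2 : c2 ≠ 0) :
    (∀ x ∈ FRTClifford.Clz q c2 N, ∀ y ∈ FRTClifford.Clz q c2 N, x * y = y * x) ∧
    (∀ n : ℕ, N = 2 * n →
      FRTClifford.Clz q c2 N = Algebra.adjoin ℂ
        {x | ∃ i : Fin N, (i : ℕ) < n ∧
          x = FRTClifford.gamma q c2 i * FRTClifford.gamma q c2 i.rev}) ∧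
    (∀ (n : ℕ) (h : N = 2 * n + 1),
      FRTClifford.Clz q c2 N = Algebra.adjoin ℂ
        ({FRTClifford.gamma q c2 (⟨n, by omega⟩ : Fin N)} ∪
          {x | ∃ i : Fin N, (i : ℕ) < n ∧
            x = FRTClifford.gamma q c2 i * FRTClifford.gamma q c2 i.rev})) := by
  
  have hQ : q ^ 2 + (q ^ 2)⁻¹ ≠ 0 := by
    intro h
    have h2 : q ^ 2 ≠ 0 := pow_ne_zero 2 hq0
    have h4 : q ^ 4 = -1 := by
      have := congrArg (q ^ 2 * ·) h
      simp only [mul_add, mul_inv_cancel₀ h2, mul_zero] at this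
      linear_combination this
    -- If `q² + q⁻²` vanished, then `q⁴ = -1` and `q` would be an eighth root of unity.
    exact hq 8 (by norm_num) (by linear_combination (q ^ 4 - 1) * h4)
  refine ⟨fun x hx y hy => FRTClifford.commute_of_mem_Clz hq0 hQ hx hy, ?_, ?_⟩
  · rintro n rfl
    rw [FRTClifford.Clz_eq_adjoin hq0 hQ]
    congr 1
    ext x
    constructor
    · rintro (⟨i, hi, -⟩ | ⟨i, hi, rfl⟩)
      · simp only [Fin.ext_iff, Fin.val_rev] at hi
        omega
      · refine ⟨i, ?_, rfl⟩
        simp only [Fin.lt_def, Fin.val_rev] at hi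
        omega
    · rintro ⟨i, hi, rfl⟩
      refine Or.inr ⟨i, ?_, rfl⟩
      simp only [Fin.lt_def, Fin.val_rev]
      omega
  · rintro n rfl
    rw [FRTClifford.Clz_eq_adjoin hq0 hQ]
    congr 1
    ext x
    constructor
    · rintro (⟨i, hi, rfl⟩ | ⟨i, hi, rfl⟩)
      · have hin : i = ⟨n, by omega⟩ := by
          simp only [Fin.ext_iff, Fin.val_rev] at hi ⊢
          omega
        exact Or.inl (by rw [hin]; rfl)
      · refine Or.inr ⟨i, ?_, rfl⟩
        simp only [Fin.lt_def, Fin.val_rev] at hi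
        omega
    · rintro (rfl | ⟨i, hi, rfl⟩)
      · refine Or.inl ⟨_, ?_, rfl⟩
        simp only [Fin.ext_iff, Fin.val_rev]
        omega
      · refine Or.inr ⟨i, ?_, rfl⟩
        simp only [Fin.lt_def, Fin.val_rev]
        omega
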